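/- Let $W_1,\dots,W_n$ be iid with the law of $|Z|$, $Z\sim N(0,1)$. Let $\mathcal H_1\subseteq\{1,\dots,n\}$ (the signals) have $m\ge 1$ elements and let $\sigma\ge 1$. In the iid Gaussian scale model one observes $X_i=\sigma W_i$ for $i\in\mathcal H_1$ and $X_i=W_i$ for $i\notin\mathcal H_1$. A top-$K$ procedure chooses a number $K\in\mathbb N$ from $X$ (measurably, possibly using external randomization) and rejects the set $R=\{i: X_i\ge \text{the } K\text{-th largest entry of } X\}$ (with $R=\emptyset$ if $K=0$ and $R=\{1,\dots,n\}$ if $K>n$). For $\alpha,\beta\in[0,1]$ it is $(\alpha,\beta)$-controlled if $\mathrm{FDR}=\mathbb E\big[|R\setminus\mathcal H_1|/(|R|\vee 1)\big]\le\alpha$ and $\mathrm{FNR}=\mathbb E\big[|\mathcal H_1\setminus R|/m\big]\le\beta$. For $n\ge2$ put $s_n=\log(n/m)/\log n$. Let $c_0\ge 1$ be a constant. (a) For every $\rho\in(0,\tfrac12)$ there is a sequence $\eta_n\in(0,1)$ with $\eta_n\to0$, depending only on $\rho$ and $c_0$, such that for all $n\ge2$, all $\mathcal H_1$ with $s_n\in[\rho,1-\rho]$,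 all $\sigma\ge1$ and all $\alpha,\beta\ge 0$ with $\max\{\alpha,\beta\}\le\frac1{3c_0}$: if an $(\alpha,\beta)$-controlled top-$K$ procedure exists, then $$\sigma\ \ge\ \frac{1}{\sqrt{2\pi}\,c_0}\,(1-\eta_n)\Big(\frac1m+\beta\Big)^{-1}\sqrt{2s_n\log n+2\log\Big(\big(\alpha+\tfrac1m\big)^{-1}\Big)} .$$ (b) For every $C\ge1$ there is $c>0$, depending only on $C$ and $c_0$, with the following property. Let $s\in(0,1)$ and $\kappa_\alpha,\kappa_\beta\ge0$ with $\max\{\kappa_\alpha,\kappa_\beta\}\le 1-s$, and suppose that for all large $n$ we have $C^{-1}n^{1-s}\le m_n\le Cn^{1-s}$, $\sigma_n\ge1$, $0\le\alpha_n\le Cn^{-\kappa_\alpha}$, $0\le\beta_n\le Cn^{-\kappa_\beta}$, $\max\{\alpha_n,\beta_n\}\le\frac1{3c_0}$, and that an $(\alpha_n,\beta_n)$-controlled top-$K$ procedure exists in the model with $m_n$ signals and strength $\sigma_n$. Then $\sigma_n\ge c\,n^{\kappa_\beta}\sqrt{2(s+\kappa_\alpha)\log n}$ for all sufficiently large $n$.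 (c) Consequently $\sigma$ grows polynomially whenever the FNR decays polynomially: for every $\rho\in(0,\tfrac12)$ and $\kappa>0$ there is $\gamma>0$ such that if, for some $C$ and all large $n$, $s_n\in[\rho,1-\rho]$, $\sigma_n\ge1$, $0\le\beta_n\le Cn^{-\kappa}$, $\alpha_n\ge0$, $\max\{\alpha_n,\beta_n\}\le\frac1{3c_0}$, and an $(\alpha_n,\beta_n)$-controlled top-$K$ procedure exists, then $\sigma_n\ge n^\gamma$ for all sufficiently large $n$. -/

import Mathlib

open MeasureTheory ProbabilityTheory Filter Topology

noncomputable section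

namespace MultTest

/-- Law of `|Z|` for a standard normal `Z`. -/
def halfNormal : Measure ℝ := (gaussianReal 0 1).map (fun z => |z|)

/-- Law of the observations `X` with `X i = W i` on the nulls and `X i = f (W i)` on the set `H₁` of
signals, when `W` has law `P`. -/
def sampleLaw {n : ℕ} (P : Measure (Fin n → ℝ)) (f : ℝ → ℝ) (H₁ : Finset (Fin n)) :
    Measure (Fin n → ℝ) :=
  P.map (fun w i => if i ∈ H₁ then f (w i) else w i)

/-- Law of the observations in the iid Gaussian scale model: iid half-normal `W`, `f w = σ * w`. -/
def gaussianScaleLaw {n : ℕ} (σ : ℝ) (H₁ : Finset (Fin n)) : Measure (Fin n → ℝ) :=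
  sampleLaw (Measure.pi (fun _ : Fin n => halfNormal)) (fun w => σ * w) H₁

/-- The indices of the `k` largest observations: `i` is selected iff fewer than `k` observations
are strictly larger than `x i`, that is, iff `x i` is at least the `k`-th largest entry of `x`
(nothing is selected for `k = 0`, everything for `k ≥ n`). -/
def topK {n : ℕ} (x : Fin n → ℝ) (k : ℕ) : Finset (Fin n) :=
  Finset.univ.filter (fun i => (Finset.univ.filter (fun j => x i < x j)).card < k)

/-- False discovery proportion of the rejection set `R`. -/
def fdp {n : ℕ} (H₁ R : Finset (Fin n)) : ℝ :=
  ((R \ H₁).card : ℝ) / max (R.card : ℝ) 1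

/-- False non-discovery proportion of the rejection set `R`. -/
def fnp {n : ℕ} (H₁ R : Finset (Fin n)) : ℝ :=
  ((H₁ \ R).card : ℝ) / (H₁.card : ℝ)

/-- False discovery rate, under observations of law `μ`, of the top-K procedure that, having
observed `x`, draws the number of rejections from `K x` (a Markov kernel; a procedure without
external randomization is a deterministic kernel). -/
def FDR {n : ℕ} (μ : Measure (Fin n → ℝ)) (H₁ : Finset (Fin n)) (K : Kernel (Fin n → ℝ) ℕ) : ℝ :=
  ∫ z, fdp H₁ (topK z.1 z.2) ∂(μ ⊗ₘ K)

/-- False non-discovery rate of the same procedure. -/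
def FNR {n : ℕ} (μ : Measure (Fin n → ℝ)) (H₁ : Finset (Fin n)) (K : Kernel (Fin n → ℝ) ℕ) : ℝ :=
  ∫ z, fnp H₁ (topK z.1 z.2) ∂(μ ⊗ₘ K)

/-- The top-K procedure `K` is `(α, β)`-controlled in the iid Gaussian scale model with signal set
`H₁` and signal strength `σ`. -/
def IsControlled {n : ℕ} (σ : ℝ) (H₁ : Finset (Fin n)) (K : Kernel (Fin n → ℝ) ℕ) (α β : ℝ) :
    Prop :=
  FDR (gaussianScaleLaw σ H₁) H₁ K ≤ α ∧ FNR (gaussianScaleLaw σ H₁) H₁ K ≤ β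

/-- The sparsity exponent `log (n / m) / log n`. -/
def sparsity (n m : ℕ) : ℝ := Real.log ((n : ℝ) / (m : ℝ)) / Real.log (n : ℝ)

end MultTest

end

/-!
Fix a level `t`. A top-K rejection set either reaches down to `t`, and then contains every
observation above `t`, so that all nulls above `t` are false discoveries
(`le_fdp_of_mem_rejectsBelow`), or it stays above `t`, and then misses every signal at most `t`
(`countIn_le_fnp_of_notMem_rejectsBelow`). This holds for every choice of the number of rejections,
however it depends on the data and on external randomness.

Let `m` be the number of signals, `L = log (n / m) + log (α + 1 / m)⁻¹` and
`t = (1 - ε) * √(2 * L)`. The expected number of nulls above `t` is far larger than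
`m * (α + 1 / m)`, by a Gaussian tail bound, and Chebyshev's inequality transfers this to the number
itself. Reaching down to `t` then produces a false discovery proportion of at least
`2.85 * (α + 1 / m)`, so by Markov's inequality it has probability `q ≤ 0.36`
(`measure_rejectsBelow_le`).

With probability `1 - q` the signals below `t` are missed; they are binomial with mean `m * p`,
`p = P(σ |Z| ≤ t)`. Their covariance with the event is at most
`√(m * p * q * (1 - q)) ≤ a * m * p + q * (1 - q) / (4 * a)`, and for `a = 0.0576` the last summand
is at most `1`, which is the reason for the `1 / m` next to `β`. This gives
`0.5824 * p ≤ β + 1 / m` (`le_card_mul_FNR`). As `β ≤ 1 / 3`, the quotient `x = t / σ` is below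
`0.85`, where `p ≥ (2 * x - x ^ 3 / 3) / √(2 * π)` suffices for `x ≤ √(2 * π) * (β + 1 / m)`
(`threshold_le_of_isControlled`).

The estimate needs only `m ≥ 300`, `2 * m ≤ n` and `L ≥ 20 / ε ^ 2`, which hold for large `n`
uniformly over sparsities in `[ρ, 1 - ρ]`, as well as under polynomial scalings. For a fixed small
`n` the lower bound is trivial with an error term close enough to `1`, because `σ ≥ 1`.
-/

namespace MultTest

/-! ### Counts of independent observations in a set -/

/-- The number, as a real, of indices in `I` at which the entry of `x` lies in `A`. -/
noncomputable def countIn {n : ℕ} (A : Set ℝ) (I : Finset (Fin n)) (x : Fin n → ℝ) : ℝ :=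
  ∑ i ∈ I, A.indicator 1 (x i)

theorem countIn_eq_card {n : ℕ} (A : Set ℝ) [DecidablePred (· ∈ A)] (I : Finset (Fin n))
    (x : Fin n → ℝ) : countIn A I x = ((I.filter (fun i => x i ∈ A)).card : ℝ) := by
  classical
  rw [countIn, Finset.card_filter]
  push_cast
  exact Finset.sum_congr rfl fun i _ => by simp [Set.indicator_apply]

theorem countIn_nonneg {n : ℕ} (A : Set ℝ) (I : Finset (Fin n)) (x : Fin n → ℝ) :
    0 ≤ countIn A I x :=
  Finset.sum_nonneg fun _ _ => Set.indicator_nonneg (fun _ _ => zero_le_one) _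

theorem countIn_le_card {n : ℕ} (A : Set ℝ) (I : Finset (Fin n)) (x : Fin n → ℝ) :
    countIn A I x ≤ I.card := by
  classical
  rw [countIn_eq_card]
  exact_mod_cast Finset.card_filter_le _ _

theorem measurable_indicator_eval {n : ℕ} {A : Set ℝ} (hA : MeasurableSet A) (i : Fin n) :
    Measurable fun x : Fin n → ℝ => A.indicator (1 : ℝ → ℝ) (x i) :=
  (measurable_one.indicator hA).comp (measurable_pi_apply i)

theorem measurable_countIn {n : ℕ} {A : Set ℝ} (hA : MeasurableSet A) (I : Finset (Fin n)) :
    Measurable (countIn A I) :=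
  Finset.measurable_fun_sum _ fun i _ => measurable_indicator_eval hA i

theorem memLp_of_bounded_nonneg {Ω : Type*} [MeasurableSpace Ω] {μ : Measure Ω}
    [IsFiniteMeasure μ] {f : Ω → ℝ} (hf : Measurable f) {c : ℝ} (h0 : ∀ x, 0 ≤ f x)
    (hc : ∀ x, f x ≤ c) (p : ENNReal) : MemLp f p μ :=
  MemLp.of_bound hf.aestronglyMeasurable c
    (ae_of_all _ fun x => by rw [Real.norm_of_nonneg (h0 x)]; exact hc x)

theorem memLp_indicator_eval {n : ℕ} {A : Set ℝ} (hA : MeasurableSet A) (i : Fin n)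
    (μ : Measure (Fin n → ℝ)) [IsFiniteMeasure μ] (p : ENNReal) :
    MemLp (fun x : Fin n → ℝ => A.indicator (1 : ℝ → ℝ) (x i)) p μ :=
  memLp_of_bounded_nonneg (measurable_indicator_eval hA i)
    (fun _ => Set.indicator_nonneg (fun _ _ => zero_le_one) _)
    (c := 1) (fun _ => Set.indicator_le' (fun _ _ => le_rfl) (fun _ _ => zero_le_one) _) p

theorem memLp_countIn {n : ℕ} {A : Set ℝ} (hA : MeasurableSet A) (I : Finset (Fin n))
    (μ : Measure (Fin n → ℝ)) [IsFiniteMeasure μ] (p : ENNReal) : MemLp (countIn A I) p μ :=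
  memLp_of_bounded_nonneg (measurable_countIn hA I) (countIn_nonneg A I) (countIn_le_card A I) p

theorem integral_indicator_eval {n : ℕ} {A : Set ℝ} (hA : MeasurableSet A)
    (ν : Fin n → Measure ℝ) [∀ i, IsProbabilityMeasure (ν i)] (i : Fin n) :
    ∫ x, A.indicator (1 : ℝ → ℝ) (x i) ∂(Measure.pi ν) = (ν i).real A := by
  rw [integral_comp_eval (μ := ν) (i := i) (f := A.indicator (1 : ℝ → ℝ))
    (measurable_one.indicator hA).aestronglyMeasurable, integral_indicator_one hA]

theorem integral_countIn {n : ℕ} {A : Set ℝ} (hA : MeasurableSet A) (I : Finset (Fin n))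
    (ν : Fin n → Measure ℝ) [∀ i, IsProbabilityMeasure (ν i)] {p : ℝ}
    (hp : ∀ i ∈ I, (ν i).real A = p) :
    ∫ x, countIn A I x ∂(Measure.pi ν) = I.card * p := by
  simp only [countIn]
  rw [integral_finsetSum _ fun i _ => (memLp_indicator_eval hA i _ 1).integrable le_rfl]
  simp_rw [integral_indicator_eval hA ν]
  rw [Finset.sum_congr rfl hp, Finset.sum_const, nsmul_eq_mul]

theorem variance_countIn_le {n : ℕ} {A : Set ℝ} (hA : MeasurableSet A) (I : Finset (Fin n))
    (ν : Fin n → Measure ℝ) [∀ i, IsProbabilityMeasure (ν i)] {p : ℝ}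
    (hp : ∀ i ∈ I, (ν i).real A = p) :
    Var[countIn A I; Measure.pi ν] ≤ I.card * p := by
  have hsum : countIn A I = ∑ i ∈ I, fun x : Fin n → ℝ => A.indicator (1 : ℝ → ℝ) (x i) := by
    ext x; simp [countIn]
  have hind := iIndepFun_pi (μ := ν) (X := fun _ => A.indicator (1 : ℝ → ℝ))
    fun i => (measurable_one.indicator hA).aemeasurable
  rw [hsum, IndepFun.variance_sum (fun i _ => memLp_indicator_eval hA i _ 2)
    (fun i _ j _ hij => hind.indepFun hij)]
  rw [← nsmul_eq_mul, ← Finset.sum_const]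
  refine Finset.sum_le_sum fun i hi => ?_
  refine (variance_le_expectation_sq
    (measurable_indicator_eval hA i).aestronglyMeasurable).trans_eq ?_
  rw [← hp i hi, ← integral_indicator_eval hA ν i]
  refine integral_congr_ae (ae_of_all _ fun x => ?_)
  by_cases h : x i ∈ A <;> simp [h]

/-- Chebyshev's inequality for the lower tail of a binomial count. -/
theorem measure_countIn_lt_half_le {n : ℕ} {A : Set ℝ} (hA : MeasurableSet A)
    (I : Finset (Fin n)) (ν : Fin n → Measure ℝ) [∀ i, IsProbabilityMeasure (ν i)] {p : ℝ}
    (hp : ∀ i ∈ I, (ν i).real A = p) (hpos : 0 < I.card * p) :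
    (Measure.pi ν).real {x | countIn A I x < I.card * p / 2} ≤ 4 / (I.card * p) := by
  have h := meas_ge_le_variance_div_sq (memLp_countIn hA I (Measure.pi ν) 2)
    (half_pos hpos)
  rw [integral_countIn hA I ν hp] at h
  have hsub : {x | countIn A I x < I.card * p / 2} ⊆
      {x | I.card * p / 2 ≤ |countIn A I x - I.card * p|} := by
    intro x hx
    simp only [Set.mem_ofPred_eq] at hx ⊢
    rw [le_abs]; right; linarith
  have hv0 := variance_nonneg (countIn A I) (Measure.pi ν)
  refine (ENNReal.toReal_le_of_le_ofReal (by positivity)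
    ((measure_mono hsub).trans h)).trans ?_
  have hv := variance_countIn_le hA I ν hp
  calc _ ≤ (I.card * p) / (I.card * p / 2) ^ 2 := by gcongr
    _ = 4 / (I.card * p) := by field_simp; norm_num

/-! ### Half-normal estimates -/

instance isProbabilityMeasure_halfNormal : IsProbabilityMeasure halfNormal :=
  Measure.isProbabilityMeasure_map (by fun_prop)

instance isProbabilityMeasure_map_scale (σ : ℝ) :
    IsProbabilityMeasure (halfNormal.map (fun w => σ * w)) :=
  Measure.isProbabilityMeasure_map (by fun_prop)

theorem gaussianReal_real_eq_integral (s : Set ℝ) :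
    (gaussianReal 0 1).real s = ∫ x in s, (√(2 * Real.pi))⁻¹ * Real.exp (-x ^ 2 / 2) := by
  rw [Measure.real, gaussianReal_apply_eq_integral 0 one_ne_zero,
    ENNReal.toReal_ofReal (integral_nonneg fun x => gaussianPDFReal_nonneg _ _ _)]
  refine integral_congr_ae (ae_of_all _ fun x => ?_)
  simp [gaussianPDFReal]

/-- The half-normal tail beyond `t` is bounded below through the Gaussian mass of `(t, t + 1]`. -/
theorem halfNormal_Ioi_ge {t : ℝ} (ht : 0 ≤ t) :
    (√(2 * Real.pi))⁻¹ * Real.exp (-(t + 1) ^ 2 / 2) ≤ halfNormal.real (Set.Ioi t) := by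
  have h1 : (gaussianReal 0 1).real (Set.Ioc t (t + 1)) ≤ halfNormal.real (Set.Ioi t) := by
    rw [halfNormal, map_measureReal_apply (by fun_prop) measurableSet_Ioi]
    refine measureReal_mono fun x hx => ?_
    exact hx.1.trans_le (le_abs_self x)
  refine le_trans ?_ h1
  rw [gaussianReal_real_eq_integral, ← intervalIntegral.integral_of_le (by linarith)]
  have hcont : Continuous fun x : ℝ => (√(2 * Real.pi))⁻¹ * Real.exp (-x ^ 2 / 2) := by fun_prop
  have := intervalIntegral.integral_mono_on (μ := volume) (a := t) (b := t + 1) (by linarith)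
    (f := fun _ => (√(2 * Real.pi))⁻¹ * Real.exp (-(t + 1) ^ 2 / 2))
    (by simp) (hcont.intervalIntegrable _ _) (fun x hx => by
      have : x ^ 2 ≤ (t + 1) ^ 2 := pow_le_pow_left₀ (ht.trans hx.1) hx.2 2
      gcongr)
  simpa using this

/-- The distribution function of `σ |Z|` is bounded below by integrating
`exp (-u ^ 2 / 2) ≥ 1 - u ^ 2 / 2`. -/
theorem halfNormal_scale_Iic_ge {σ x : ℝ} (hσ : 0 < σ) (hx : 0 ≤ x) :
    (√(2 * Real.pi))⁻¹ * (2 * x - x ^ 3 / 3) ≤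
      (halfNormal.map (fun w => σ * w)).real (Set.Iic (σ * x)) := by
  have h1 : (gaussianReal 0 1).real (Set.Ioc (-x) x) ≤
      (halfNormal.map (fun w => σ * w)).real (Set.Iic (σ * x)) := by
    rw [map_measureReal_apply (by fun_prop) measurableSet_Iic, halfNormal,
      map_measureReal_apply (by fun_prop) (measurableSet_Iic.preimage (by fun_prop))]
    refine measureReal_mono fun y hy => ?_
    simp only [Set.mem_preimage, Set.mem_Iic]
    have : |y| ≤ x := abs_le.2 ⟨hy.1.le, hy.2⟩
    gcongr
  refine le_trans ?_ h1
  rw [gaussianReal_real_eq_integral, ← intervalIntegral.integral_of_le (by linarith)]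
  have hcont : Continuous fun x : ℝ => (√(2 * Real.pi))⁻¹ * Real.exp (-x ^ 2 / 2) := by fun_prop
  have hcont' : Continuous fun x : ℝ => (√(2 * Real.pi))⁻¹ * (1 - x ^ 2 / 2) := by fun_prop
  have := intervalIntegral.integral_mono_on (μ := volume) (a := -x) (b := x) (by linarith)
    (hcont'.intervalIntegrable _ _) (hcont.intervalIntegrable _ _) (fun u _ => by
      have := Real.one_sub_le_exp_neg (u ^ 2 / 2)
      rw [neg_div]
      gcongr)
  refine le_trans (le_of_eq ?_) this
  rw [intervalIntegral.integral_const_mul, intervalIntegral.integral_sub (by simp)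
    (by apply Continuous.intervalIntegrable; fun_prop), intervalIntegral.integral_div]
  simp only [intervalIntegral.integral_const, integral_pow, smul_eq_mul]
  ring

/-- The observations of the Gaussian scale model are independent. -/
theorem gaussianScaleLaw_eq_pi {n : ℕ} (σ : ℝ) (H₁ : Finset (Fin n)) :
    gaussianScaleLaw σ H₁ = Measure.pi
      (fun i => if i ∈ H₁ then halfNormal.map (fun w => σ * w) else halfNormal) := by
  have h := Measure.pi_map_pi (μ := fun _ : Fin n => halfNormal)
    (f := fun i w => if i ∈ H₁ then σ * w else w)
    (hμ := fun i => by
      have : IsProbabilityMeasure (halfNormal.map (fun w => if i ∈ H₁ then σ * w else w)) :=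
        Measure.isProbabilityMeasure_map (by split_ifs <;> fun_prop)
      infer_instance)
    (fun i => by split_ifs <;> fun_prop)
  rw [gaussianScaleLaw, sampleLaw, h]
  congr 1
  ext1 i
  split_ifs
  · rfl
  · exact Measure.map_id'

instance isProbabilityMeasure_ite (p : Prop) [Decidable p] (μ ν : Measure ℝ)
    [IsProbabilityMeasure μ] [IsProbabilityMeasure ν] :
    IsProbabilityMeasure (if p then μ else ν) := by
  split_ifs <;> infer_instance

/-! ### Top-K rejection sets -/

/-- A top-K rejection set that reaches down to `t` contains every observation above `t`. -/
theorem mem_topK_of_lt {n : ℕ} {x : Fin n → ℝ} {k : ℕ} {t : ℝ}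
    (h : ∃ i ∈ topK x k, x i ≤ t) {j : Fin n} (hj : t < x j) : j ∈ topK x k := by
  obtain ⟨i, hi, hit⟩ := h
  simp only [topK, Finset.mem_filter, Finset.mem_univ, true_and] at hi ⊢
  refine (Finset.card_le_card fun l hl => ?_).trans_lt hi
  simp only [Finset.mem_filter, Finset.mem_univ, true_and] at hl ⊢
  exact (hit.trans_lt hj).trans hl

theorem measurableSet_mem_topK {n : ℕ} (i : Fin n) :
    MeasurableSet {z : (Fin n → ℝ) × ℕ | i ∈ topK z.1 z.2} := by
  have hm : Measurable fun z : (Fin n → ℝ) × ℕ =>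
      ∑ j : Fin n, if z.1 i < z.1 j then (1 : ℕ) else 0 :=
    Finset.measurable_fun_sum _ fun j _ => Measurable.ite
      (measurableSet_lt (by fun_prop) (by fun_prop)) measurable_const measurable_const
  convert measurableSet_lt hm measurable_snd using 1
  ext z
  simp only [topK, Finset.mem_filter, Finset.mem_univ, true_and, Finset.card_filter,
    Set.mem_ofPred_eq]

theorem measurable_comp_topK {n : ℕ} (g : Finset (Fin n) → ℝ) :
    Measurable fun z : (Fin n → ℝ) × ℕ => g (topK z.1 z.2) := by
  let _ : MeasurableSpace (Finset (Fin n)) := ⊤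
  have hg : Measurable g := measurable_from_top
  refine hg.comp (measurable_to_countable' fun R => ?_)
  have : (fun z : (Fin n → ℝ) × ℕ => topK z.1 z.2) ⁻¹' {R} =
      ⋂ i, {z | i ∈ topK z.1 z.2 ↔ i ∈ R} := by
    ext z; simp [Finset.ext_iff]
  rw [this]
  exact MeasurableSet.iInter fun i => (measurableSet_mem_topK i).iff (MeasurableSet.const _)

theorem integrable_comp_topK {n : ℕ} (g : Finset (Fin n) → ℝ)
    (ν : Measure ((Fin n → ℝ) × ℕ)) [IsFiniteMeasure ν] :
    Integrable (fun z => g (topK z.1 z.2)) ν :=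
  Integrable.of_bound (measurable_comp_topK g).aestronglyMeasurable (∑ R, ‖g R‖)
    (ae_of_all _ fun _ => Finset.single_le_sum (f := fun R => ‖g R‖)
      (fun _ _ => norm_nonneg _) (Finset.mem_univ _))

theorem fdp_nonneg {n : ℕ} (H₁ R : Finset (Fin n)) : 0 ≤ fdp H₁ R := by
  unfold fdp; positivity

theorem fnp_nonneg {n : ℕ} (H₁ R : Finset (Fin n)) : 0 ≤ fnp H₁ R := by
  unfold fnp; positivity

/-- The event that some rejected observation is at most `t`. -/
def rejectsBelow {n : ℕ} (t : ℝ) : Set ((Fin n → ℝ) × ℕ) :=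
  {z | ∃ i ∈ topK z.1 z.2, z.1 i ≤ t}

theorem measurableSet_rejectsBelow {n : ℕ} (t : ℝ) :
    MeasurableSet (rejectsBelow t : Set ((Fin n → ℝ) × ℕ)) := by
  have : (rejectsBelow t : Set ((Fin n → ℝ) × ℕ)) =
      ⋃ i, {z | i ∈ topK z.1 z.2} ∩ {z | z.1 i ≤ t} := by
    ext z; simp [rejectsBelow]
  rw [this]
  exact MeasurableSet.iUnion fun i => (measurableSet_mem_topK i).inter
    (measurableSet_le (by fun_prop) measurable_const)

/-- If the rejections reach down to `t`, every null above `t` is a false discovery; at most `|H₁|`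
rejections are true discoveries. -/
theorem le_fdp_of_mem_rejectsBelow {n : ℕ} {H₁ : Finset (Fin n)} (hne : H₁.Nonempty)
    {t Q l : ℝ} (hl : l ≤ 1) (hQ : l * H₁.card ≤ (1 - l) * Q)
    {z : (Fin n → ℝ) × ℕ} (hz : z ∈ rejectsBelow t) (hN : Q ≤ countIn (Set.Ioi t) H₁ᶜ z.1) :
    l ≤ fdp H₁ (topK z.1 z.2) := by
  classical
  set R := topK z.1 z.2
  have hFP : countIn (Set.Ioi t) H₁ᶜ z.1 ≤ ((R \ H₁).card : ℝ) := by
    rw [countIn_eq_card]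
    refine Nat.cast_le.2 (Finset.card_le_card fun j hj => ?_)
    simp only [Finset.mem_filter, Finset.mem_compl, Set.mem_Ioi] at hj
    exact Finset.mem_sdiff.2 ⟨mem_topK_of_lt hz hj.2, hj.1⟩
  have hR : (R.card : ℝ) ≤ (R \ H₁).card + H₁.card := by
    exact_mod_cast Finset.card_le_card_sdiff_add_card
  have hm : (1 : ℝ) ≤ H₁.card := by exact_mod_cast hne.card_pos
  have hmax : max (R.card : ℝ) 1 ≤ (R \ H₁).card + H₁.card :=
    max_le hR (hm.trans (le_add_of_nonneg_left (Nat.cast_nonneg _)))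
  have hmax0 : 0 < max (R.card : ℝ) 1 := lt_max_of_lt_right one_pos
  rcases le_or_gt l 0 with h0 | h0
  · exact h0.trans (fdp_nonneg _ _)
  rw [fdp, le_div_iff₀ hmax0]
  calc l * max (R.card : ℝ) 1 ≤ l * ((R \ H₁).card + H₁.card) := by gcongr
    _ ≤ ((R \ H₁).card : ℝ) := by
      have : (1 - l) * Q ≤ (1 - l) * ((R \ H₁).card : ℝ) :=
        mul_le_mul_of_nonneg_left (hN.trans hFP) (by linarith)
      linarith

/-- If the rejections stay above `t`, every signal at most `t` is missed. -/
theorem countIn_le_fnp_of_notMem_rejectsBelow {n : ℕ} {H₁ : Finset (Fin n)}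
    (hne : H₁.Nonempty) {t : ℝ} {z : (Fin n → ℝ) × ℕ} (hz : z ∉ rejectsBelow t) :
    countIn (Set.Iic t) H₁ z.1 ≤ H₁.card * fnp H₁ (topK z.1 z.2) := by
  classical
  have hm : (H₁.card : ℝ) ≠ 0 := by exact_mod_cast hne.card_pos.ne'
  rw [fnp, mul_div_cancel₀ _ hm, countIn_eq_card]
  refine Nat.cast_le.2 (Finset.card_le_card fun j hj => ?_)
  simp only [Finset.mem_filter, Set.mem_Iic] at hj
  exact Finset.mem_sdiff.2 ⟨hj.1, fun hjR => hz ⟨j, hjR, hj.2⟩⟩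

/-! ### Error rates and the event that the rejections reach down to a level -/

instance isProbabilityMeasure_gaussianScaleLaw {n : ℕ} (σ : ℝ) (H₁ : Finset (Fin n)) :
    IsProbabilityMeasure (gaussianScaleLaw σ H₁) := by
  rw [gaussianScaleLaw_eq_pi]; infer_instance

/-- A small false discovery rate makes it unlikely that the rejections reach down to a level above
which there are many nulls. -/
theorem mul_measure_rejectsBelow_le_FDR {n : ℕ} {H₁ : Finset (Fin n)} (hne : H₁.Nonempty)
    (μ : Measure (Fin n → ℝ)) [IsProbabilityMeasure μ]
    (K : Kernel (Fin n → ℝ) ℕ) [IsMarkovKernel K] {t Q l : ℝ} (hl0 : 0 ≤ l) (hl : l ≤ 1)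
    (hQ : l * H₁.card ≤ (1 - l) * Q) :
    l * (μ ⊗ₘ K).real (rejectsBelow t) ≤
      FDR μ H₁ K + l * μ.real {x | countIn (Set.Ioi t) H₁ᶜ x < Q} := by
  set ν := μ ⊗ₘ K
  set f : (Fin n → ℝ) × ℕ → ℝ := fun z => fdp H₁ (topK z.1 z.2)
  have hmarkov := mul_meas_ge_le_integral_of_nonneg (μ := ν) (f := f)
    (ae_of_all _ fun z => fdp_nonneg _ _) (integrable_comp_topK (fdp H₁) ν) l
  have hsub : (rejectsBelow t : Set ((Fin n → ℝ) × ℕ)) ⊆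
      {z | l ≤ f z} ∪ Prod.fst ⁻¹' {x | countIn (Set.Ioi t) H₁ᶜ x < Q} := by
    intro z hz
    by_cases hN : Q ≤ countIn (Set.Ioi t) H₁ᶜ z.1
    · exact Or.inl (le_fdp_of_mem_rejectsBelow hne hl hQ hz hN)
    · exact Or.inr (not_le.1 hN)
  have hfst : ν.real (Prod.fst ⁻¹' {x | countIn (Set.Ioi t) H₁ᶜ x < Q}) =
      μ.real {x | countIn (Set.Ioi t) H₁ᶜ x < Q} := by
    rw [← Measure.fst_compProd μ K, Measure.fst, map_measureReal_apply measurable_fst]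
    exact measurableSet_lt (measurable_countIn measurableSet_Ioi _) measurable_const
  have h1 := (measureReal_mono (μ := ν) hsub).trans (measureReal_union_le _ _)
  rw [hfst] at h1
  calc l * ν.real (rejectsBelow t) ≤ l * (ν.real {z | l ≤ f z} +
        μ.real {x | countIn (Set.Ioi t) H₁ᶜ x < Q}) := by gcongr
    _ ≤ _ := by rw [mul_add]; exact add_le_add_left hmarkov _

/-- Lower bound for the false non-discovery rate, where `q` is the probability that the rejections
reach down to `t`. The number of signals below `t` may depend on that event; the covariance is
bounded by `u * v ≤ a * u ^ 2 + v ^ 2 / (4 * a)`, so that no concentration of the number is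
needed. -/
theorem le_card_mul_FNR {n : ℕ} {H₁ : Finset (Fin n)} (hne : H₁.Nonempty)
    (σ : ℝ) (K : Kernel (Fin n → ℝ) ℕ) [IsMarkovKernel K] {t a p q : ℝ} (ha : 0 < a)
    (hp : (halfNormal.map (fun w => σ * w)).real (Set.Iic t) = p)
    (hq : (gaussianScaleLaw σ H₁ ⊗ₘ K).real (rejectsBelow t) = q) :
    H₁.card * p * (1 - q - a) - q * (1 - q) / (4 * a) ≤
      H₁.card * FNR (gaussianScaleLaw σ H₁) H₁ K := by
  classical
  set μ := gaussianScaleLaw σ H₁ with hμ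
  set ν := μ ⊗ₘ K with hν
  set N : (Fin n → ℝ) → ℝ := countIn (Set.Iic t) H₁ with hN
  set M : ℝ := H₁.card * p with hM
  set s : (Fin n → ℝ) × ℕ → ℝ := (rejectsBelow t).indicator 1
  have hp' : ∀ i ∈ H₁, (if i ∈ H₁ then halfNormal.map (fun w => σ * w) else halfNormal).real
      (Set.Iic t) = p := fun i hi => by rw [if_pos hi, hp]
  have hNmeas : Measurable N := measurable_countIn measurableSet_Iic _
  have hmean : ∫ x, N x ∂μ = M := by
    rw [hμ, gaussianScaleLaw_eq_pi]; exact integral_countIn measurableSet_Iic _ _ hp'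
  have hvar : ∫ x, (N x - M) ^ 2 ∂μ ≤ M := by
    have h := variance_countIn_le measurableSet_Iic H₁ _ hp'
    rw [← gaussianScaleLaw_eq_pi, variance_eq_integral hNmeas.aemeasurable] at h
    rwa [hmean] at h
  have hmap : ν.map Prod.fst = μ := Measure.fst_compProd μ K
  have hNint : Integrable (fun z => N z.1) ν := by
    have : Integrable N (ν.map Prod.fst) := by
      rw [hmap]; exact (memLp_countIn measurableSet_Iic _ μ 1).integrable le_rfl
    exact this.comp_measurable measurable_fst
  have hYint : Integrable (fun z => (N z.1 - M) ^ 2) ν := by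
    have : Integrable (fun x => (N x - M) ^ 2) (ν.map Prod.fst) := by
      rw [hmap]
      exact ((memLp_countIn measurableSet_Iic _ μ 2).sub (memLp_const M)).integrable_sq
    exact this.comp_measurable measurable_fst
  have hmean' : ∫ z, N z.1 ∂ν = M := by
    rw [← hmean, ← hmap, integral_map measurable_fst.aemeasurable
      hNmeas.aestronglyMeasurable]
  have hvar' : ∫ z, (N z.1 - M) ^ 2 ∂ν ≤ M := by
    refine le_trans (le_of_eq ?_) hvar
    rw [← hmap, integral_map measurable_fst.aemeasurable
      ((hNmeas.sub_const M).pow_const 2).aestronglyMeasurable]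
  have hsint : Integrable s ν :=
    (integrable_const (1 : ℝ)).indicator (measurableSet_rejectsBelow t)
  have hs : ∫ z, s z ∂ν = q := by
    rw [integral_indicator_one (measurableSet_rejectsBelow t), hq]
  have hpoint : ∀ z : (Fin n → ℝ) × ℕ,
      M * (1 - s z) + (1 - q) * (N z.1 - M) - a * (N z.1 - M) ^ 2 -
        (s z * (1 - 2 * q) + q ^ 2) / (4 * a) ≤ H₁.card * fnp H₁ (topK z.1 z.2) := by
    intro z
    by_cases hz : z ∈ rejectsBelow t
    · have h1 : s z = 1 := by simp [s, hz]
      have h2 : 0 ≤ H₁.card * fnp H₁ (topK z.1 z.2) :=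
        mul_nonneg (Nat.cast_nonneg _) (fnp_nonneg _ _)
      refine le_trans ?_ h2
      have h3 : M * (1 - s z) + (1 - q) * (N z.1 - M) - a * (N z.1 - M) ^ 2 -
          (s z * (1 - 2 * q) + q ^ 2) / (4 * a) =
          -((2 * a * (N z.1 - M) - (1 - q)) ^ 2 / (4 * a)) := by
        rw [h1]; field_simp; ring
      rw [h3, neg_nonpos]; positivity
    · have h1 : s z = 0 := by simp [s, hz]
      refine le_trans ?_ (countIn_le_fnp_of_notMem_rejectsBelow hne hz)
      have h3 : M * (1 - s z) + (1 - q) * (N z.1 - M) - a * (N z.1 - M) ^ 2 -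
          (s z * (1 - 2 * q) + q ^ 2) / (4 * a) =
          N z.1 - (2 * a * (N z.1 - M) + q) ^ 2 / (4 * a) := by
        rw [h1]; field_simp; ring
      rw [h3, sub_le_self_iff]; positivity
  have i1 : Integrable (fun z => M * (1 - s z)) ν :=
    ((integrable_const (1 : ℝ)).sub hsint).const_mul M
  have i2 : Integrable (fun z => (1 - q) * (N z.1 - M)) ν :=
    (hNint.sub (integrable_const M)).const_mul _
  have i3 : Integrable (fun z => a * (N z.1 - M) ^ 2) ν := hYint.const_mul a
  have i4 : Integrable (fun z => (s z * (1 - 2 * q) + q ^ 2) / (4 * a)) ν :=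
    ((hsint.mul_const _).add (integrable_const _)).div_const _
  have i12 : Integrable (fun z => M * (1 - s z) + (1 - q) * (N z.1 - M)) ν := i1.add i2
  have i123 : Integrable (fun z => M * (1 - s z) + (1 - q) * (N z.1 - M) -
    a * (N z.1 - M) ^ 2) ν := i12.sub i3
  have hle := integral_mono (i123.sub i4)
    ((integrable_comp_topK (fnp H₁) ν).const_mul (H₁.card : ℝ)) hpoint
  rw [integral_const_mul] at hle
  refine le_trans ?_ hle
  have e1 : ∫ z, M * (1 - s z) ∂ν = M * (1 - q) := by
    rw [integral_const_mul, integral_sub (integrable_const _) hsint, hs]; simp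
  have e2 : ∫ z, (1 - q) * (N z.1 - M) ∂ν = 0 := by
    rw [integral_const_mul, integral_sub hNint (integrable_const _), hmean']; simp
  have e4 : ∫ z, (s z * (1 - 2 * q) + q ^ 2) / (4 * a) ∂ν = q * (1 - q) / (4 * a) := by
    rw [integral_div, integral_add (hsint.mul_const _) (integrable_const _),
      integral_mul_const, hs]
    simp
    ring
  have e : ∫ z, (M * (1 - s z) + (1 - q) * (N z.1 - M) - a * (N z.1 - M) ^ 2 -
        (s z * (1 - 2 * q) + q ^ 2) / (4 * a)) ∂ν =
      M * (1 - q) + 0 - a * ∫ z, (N z.1 - M) ^ 2 ∂ν - q * (1 - q) / (4 * a) := by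
    rw [integral_sub i123 i4, integral_sub i12 i3,
      integral_add i1 i2, e1, e2, e4, integral_const_mul]
  refine le_trans ?_ e.ge
  have := mul_le_mul_of_nonneg_left hvar' ha.le
  linarith

/-! ### The lower bound on the signal strength -/

theorem exp_ten_ge : 6000 ≤ Real.exp 10 := by
  have h1 : (2.7 : ℝ) ≤ Real.exp 1 := by have := Real.exp_one_gt_d9; linarith
  have h2 : Real.exp 10 = Real.exp 1 ^ 10 := by rw [← Real.exp_nat_mul]; norm_num
  rw [h2]
  calc (6000 : ℝ) ≤ 2.7 ^ 10 := by norm_num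
    _ ≤ _ := by gcongr

theorem sqrt_two_pi_le : √(2 * Real.pi) ≤ 2.507 := by
  rw [Real.sqrt_le_left (by norm_num)]
  have := Real.pi_lt_d4
  norm_num
  linarith

theorem sqrt_two_pi_pos : 0 < √(2 * Real.pi) := by have := Real.pi_pos; positivity

/-- At a level slightly below `√(2 * L)` the Gaussian tail is far larger than `exp (-L)`. -/
theorem mul_exp_neg_le_exp_neg_sq {ε L : ℝ} (hε0 : 0 < ε) (hε1 : ε ≤ 1) (hL : 20 / ε ^ 2 ≤ L) :
    6000 * Real.exp (-L) ≤ Real.exp (-((1 - ε) * √(2 * L) + 1) ^ 2 / 2) := by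
  rw [div_le_iff₀ (by positivity)] at hL
  have hL0 : 0 ≤ L := by
    by_contra! h
    have := mul_neg_of_neg_of_pos h (pow_pos hε0 2)
    linarith
  set r := √(2 * L)
  have hr0 : 0 ≤ r := Real.sqrt_nonneg _
  have hr : r ^ 2 = 2 * L := Real.sq_sqrt (by linarith)
  have hεr : 2 ≤ ε * r := by
    refine le_of_sq_le_sq ?_ (by positivity)
    rw [mul_pow, hr]
    linarith
  have hsq : ((1 - ε) * r + 1) ^ 2 ≤ (1 - ε / 2) * (2 * L) := by
    calc ((1 - ε) * r + 1) ^ 2 ≤ ((1 - ε / 2) * r) ^ 2 := by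
          refine pow_le_pow_left₀ (add_nonneg (mul_nonneg (by linarith) hr0) zero_le_one) ?_ 2
          linarith
      _ = (1 - ε / 2) ^ 2 * (2 * L) := by rw [mul_pow, hr]
      _ ≤ (1 - ε / 2) * (2 * L) := by
          refine mul_le_mul_of_nonneg_right ?_ (by linarith)
          nlinarith
  have hεL : 20 ≤ ε * L := by
    have : ε * (ε * L) ≤ 1 * (ε * L) := mul_le_mul_of_nonneg_right hε1 (by positivity)
    linarith
  calc 6000 * Real.exp (-L) ≤ Real.exp 10 * Real.exp (-L) := by
        gcongr; exact exp_ten_ge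
    _ = Real.exp (10 - L) := by rw [← Real.exp_add]; ring_nf
    _ ≤ _ := Real.exp_le_exp.2 (by linarith)

/-- Rejections below the level `(1 - ε) * √(2 * log (n / (m * (α + 1 / m))))` are unlikely: there
the nulls outnumber what a false discovery rate of `α` permits. -/
theorem measure_rejectsBelow_le {n : ℕ} {H₁ : Finset (Fin n)} {σ α β ε L : ℝ}
    {K : Kernel (Fin n → ℝ) ℕ} [IsMarkovKernel K] (hm : 300 ≤ H₁.card) (hmn : 2 * H₁.card ≤ n)
    (hα0 : 0 ≤ α) (hα : α ≤ 1 / 3) (hε0 : 0 < ε) (hε1 : ε ≤ 1)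
    (hL : L = Real.log ((n : ℝ) / (H₁.card : ℝ)) + Real.log ((α + 1 / (H₁.card : ℝ))⁻¹))
    (hLε : 20 / ε ^ 2 ≤ L) (hK : IsControlled σ H₁ K α β) :
    (gaussianScaleLaw σ H₁ ⊗ₘ K).real (rejectsBelow ((1 - ε) * √(2 * L))) ≤ 0.36 := by
  have hm' : (300 : ℝ) ≤ H₁.card := by exact_mod_cast hm
  have hmn' : 2 * (H₁.card : ℝ) ≤ n := by exact_mod_cast hmn
  have hne : H₁.Nonempty := Finset.card_pos.1 (by omega)
  have hcompl : ((H₁ᶜ).card : ℝ) = n - H₁.card := by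
    rw [Finset.card_compl, Fintype.card_fin, Nat.cast_sub (by omega)]
  set m : ℝ := (H₁.card : ℝ)
  have hm0 : 0 < m := by linarith
  have hn0 : (0 : ℝ) < n := by linarith
  have hinv : 1 / m ≤ 1 / 300 := one_div_le_one_div_of_le (by norm_num) hm'
  have hinv0 : 0 < 1 / m := by positivity
  set α' : ℝ := α + 1 / m with hα'
  have hα'0 : 0 < α' := by linarith
  have hmα' : 1 ≤ m * α' := by
    rw [hα', mul_add, mul_one_div_cancel hm0.ne']
    have := mul_nonneg hm0.le hα0
    linarith
  set t : ℝ := (1 - ε) * √(2 * L) with ht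
  have ht0 : 0 ≤ t := mul_nonneg (by linarith) (Real.sqrt_nonneg _)
  have hexpL : n * Real.exp (-L) = m * α' := by
    rw [hL, ← Real.log_mul (by positivity) (by positivity), Real.exp_neg,
      Real.exp_log (by positivity)]
    field_simp
  -- The expected number of nulls above `t` is at least `1000 * m * α'`.
  set p₀ := halfNormal.real (Set.Ioi t) with hp₀
  have hp₀le : (√(2 * Real.pi))⁻¹ * (6000 * Real.exp (-L)) ≤ p₀ :=
    (mul_le_mul_of_nonneg_left (mul_exp_neg_le_exp_neg_sq hε0 hε1 hLε)
      (inv_nonneg.2 sqrt_two_pi_pos.le)).trans (halfNormal_Ioi_ge ht0)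
  have hsq : (0.398 : ℝ) ≤ (√(2 * Real.pi))⁻¹ := by
    rw [le_inv_comm₀ (by norm_num) sqrt_two_pi_pos]
    exact sqrt_two_pi_le.trans (by norm_num)
  have hE : 1000 * (m * α') ≤ (H₁ᶜ).card * p₀ := by
    rw [hcompl]
    calc 1000 * (m * α') ≤ (n / 2) * (0.398 * (6000 * Real.exp (-L))) := by
          rw [← hexpL]
          have := mul_pos hn0 (Real.exp_pos (-L))
          linarith
      _ ≤ (n / 2) * p₀ := by
          refine mul_le_mul_of_nonneg_left (le_trans ?_ hp₀le) (by positivity)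
          gcongr
      _ ≤ (n - m) * p₀ := mul_le_mul_of_nonneg_right (by linarith) measureReal_nonneg
  have hpν : ∀ i ∈ H₁ᶜ, (if i ∈ H₁ then halfNormal.map (fun w => σ * w) else halfNormal).real
      (Set.Ioi t) = p₀ := fun i hi => by rw [if_neg (Finset.mem_compl.1 hi)]
  have hfew : (gaussianScaleLaw σ H₁).real
      {x | countIn (Set.Ioi t) H₁ᶜ x < 72 * (m * α')} ≤ 0.004 := by
    rw [gaussianScaleLaw_eq_pi]
    refine (measureReal_mono fun x hx => ?_).trans
      ((measure_countIn_lt_half_le measurableSet_Ioi H₁ᶜ _ hpν (by linarith)).trans ?_)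
    · rw [Set.mem_ofPred_eq] at hx ⊢
      linarith
    · rw [div_le_iff₀ (by linarith)]
      linarith
  -- The proportion `l = 2.85 * α'` is at most `0.96`, so `72 * m * α'` false discoveries force it,
  -- and Markov's inequality leaves a probability of at most `1 / 2.85 + 0.004 < 0.36`.
  have hFDR := mul_measure_rejectsBelow_le_FDR hne (gaussianScaleLaw σ H₁) K (t := t)
    (Q := 72 * (m * α')) (l := 2.85 * α') (by positivity) (by linarith) (by
      have : (0.04 : ℝ) * (72 * (m * α')) ≤ (1 - 2.85 * α') * (72 * (m * α')) :=
        mul_le_mul_of_nonneg_right (by linarith) (by positivity)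
      refine le_trans ?_ this
      linarith)
  have h1 : 2.85 * α' * (gaussianScaleLaw σ H₁).real
      {x | countIn (Set.Ioi t) H₁ᶜ x < 72 * (m * α')} ≤ 2.85 * α' * 0.004 := by gcongr
  have h2 : 2.85 * α' * (gaussianScaleLaw σ H₁ ⊗ₘ K).real (rejectsBelow t) ≤
      2.85 * α' * 0.36 := by
    have := hK.1
    linarith
  exact le_of_mul_le_mul_left h2 (by positivity)

/-- The signals below `σ * x` make up a fraction of about `√(2 / π) * x` of all signals; a rate of
false non-discoveries of at most `1 / 3` keeps `x` in the range where this approximation is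
accurate to within the constant in the bound. -/
theorem threshold_le_of_isControlled {n : ℕ} {H₁ : Finset (Fin n)} {σ α β ε L : ℝ}
    {K : Kernel (Fin n → ℝ) ℕ} [IsMarkovKernel K] (hm : 300 ≤ H₁.card) (hmn : 2 * H₁.card ≤ n)
    (hσ : 0 < σ) (hα0 : 0 ≤ α) (hα : α ≤ 1 / 3) (hβ : β ≤ 1 / 3) (hε0 : 0 < ε) (hε1 : ε ≤ 1)
    (hL : L = Real.log ((n : ℝ) / (H₁.card : ℝ)) + Real.log ((α + 1 / (H₁.card : ℝ))⁻¹))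
    (hLε : 20 / ε ^ 2 ≤ L) (hK : IsControlled σ H₁ K α β) :
    (1 - ε) * √(2 * L) ≤ √(2 * Real.pi) * σ * (1 / (H₁.card : ℝ) + β) := by
  have hq := measure_rejectsBelow_le hm hmn hα0 hα hε0 hε1 hL hLε hK
  have hne : H₁.Nonempty := Finset.card_pos.1 (by omega)
  have hm' : (300 : ℝ) ≤ H₁.card := by exact_mod_cast hm
  set t : ℝ := (1 - ε) * √(2 * L) with ht
  have ht0 : 0 ≤ t := mul_nonneg (by linarith) (Real.sqrt_nonneg _)
  obtain ⟨x, hx⟩ : ∃ x, t = σ * x := ⟨t / σ, by field_simp⟩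
  have hx0 : 0 ≤ x := by rw [hx] at ht0; exact nonneg_of_mul_nonneg_right ht0 hσ
  set p := (halfNormal.map (fun w => σ * w)).real (Set.Iic t) with hp
  have hp0 : 0 ≤ p := measureReal_nonneg
  set q := (gaussianScaleLaw σ H₁ ⊗ₘ K).real (rejectsBelow t) with hqdef
  have hFNR := le_card_mul_FNR hne σ K (a := 0.0576) (by norm_num) hp.symm hqdef.symm
  set m : ℝ := (H₁.card : ℝ)
  have hm0 : 0 < m := by linarith
  have hinv : 1 / m ≤ 1 / 300 := one_div_le_one_div_of_le (by norm_num) hm'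
  -- `0.0576 = q * (1 - q) / 4` at `q = 0.36`, so the last term of the bound is at most `1`.
  have hq1 : q * (1 - q) / (4 * 0.0576) ≤ 1 := by
    rw [div_le_one (by norm_num)]
    have : 0 ≤ (0.36 - q) * (0.64 - q) := mul_nonneg (by linarith) (by linarith)
    nlinarith
  have hpβ : 0.5824 * p ≤ 1 / m + β := by
    have h1 : m * p * 0.5824 ≤ m * p * (1 - q - 0.0576) :=
      mul_le_mul_of_nonneg_left (by linarith) (by positivity)
    have h2 : m * FNR (gaussianScaleLaw σ H₁) H₁ K ≤ m * β :=
      mul_le_mul_of_nonneg_left hK.2 hm0.le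
    refine le_of_mul_le_mul_left ?_ hm0
    rw [mul_add, mul_one_div_cancel hm0.ne']
    linarith
  have hs0 := sqrt_two_pi_pos
  have hcdf : ∀ y, 0 ≤ y → y ≤ x → 2 * y - y ^ 3 / 3 ≤ √(2 * Real.pi) * p := by
    intro y hy0 hy
    have h1 := halfNormal_scale_Iic_ge hσ hy0
    rw [inv_mul_le_iff₀ hs0] at h1
    refine h1.trans (mul_le_mul_of_nonneg_left (measureReal_mono ?_) hs0.le)
    rw [hx]
    exact Set.Iic_subset_Iic.2 (mul_le_mul_of_nonneg_left hy hσ.le)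
  -- At `x = 0.85` the bound on `p` would exceed `0.5785`, more than `β ≤ 1 / 3` permits; below it
  -- `0.5824 * (2 - x ^ 2 / 3) ≥ 1`.
  have hx1 : x < 0.85 := by
    by_contra! h
    have h1 := hcdf 0.85 (by norm_num) h
    have h2 : √(2 * Real.pi) * p ≤ 2.507 * 0.5785 :=
      mul_le_mul sqrt_two_pi_le (by linarith) hp0 (by norm_num)
    norm_num at h1 h2
    linarith
  have hx3 : x ^ 3 ≤ 0.85 ^ 2 * x := by
    rw [pow_succ]
    gcongr
  have h1 := hcdf x hx0 le_rfl
  have h2 : √(2 * Real.pi) * (0.5824 * p) ≤ √(2 * Real.pi) * (1 / m + β) :=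
    mul_le_mul_of_nonneg_left hpβ hs0.le
  have h3 : x ≤ √(2 * Real.pi) * (1 / m + β) := by
    norm_num at hx3
    linarith
  calc t = σ * x := hx
    _ ≤ σ * (√(2 * Real.pi) * (1 / m + β)) := mul_le_mul_of_nonneg_left h3 hσ.le
    _ = _ := by ring

/-- The bound solved for the signal strength, with `log (n / m)` and `log (α + 1 / m)⁻¹` collected
in any lower bound `L`. -/
theorem signal_strength_ge {n : ℕ} {H₁ : Finset (Fin n)} {σ α β ε b L : ℝ}
    {K : Kernel (Fin n → ℝ) ℕ} [IsMarkovKernel K] (hm : 300 ≤ H₁.card) (hmn : 2 * H₁.card ≤ n)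
    (hσ : 0 < σ) (hα0 : 0 ≤ α) (hα : α ≤ 1 / 3) (hβ0 : 0 ≤ β) (hβ : β ≤ 1 / 3) (hε0 : 0 < ε)
    (hε1 : ε ≤ 1) (hLε : 20 / ε ^ 2 ≤ L)
    (hL : L ≤ Real.log ((n : ℝ) / (H₁.card : ℝ)) + Real.log ((α + 1 / (H₁.card : ℝ))⁻¹))
    (hb : 1 / (H₁.card : ℝ) + β ≤ b) (hK : IsControlled σ H₁ K α β) :
    (√(2 * Real.pi))⁻¹ * (1 - ε) * b⁻¹ * √(2 * L) ≤ σ := by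
  have h := threshold_le_of_isControlled hm hmn hσ hα0 hα hβ hε0 hε1 rfl (hLε.trans hL) hK
  have hm0 : (0 : ℝ) < H₁.card := by exact_mod_cast (by omega : 0 < H₁.card)
  have hb0 : 0 < b := lt_of_lt_of_le (by positivity) hb
  have hs0 := sqrt_two_pi_pos
  have h2 : (1 - ε) * √(2 * L) ≤ √(2 * Real.pi) * σ * b := by
    refine le_trans (mul_le_mul_of_nonneg_left (Real.sqrt_le_sqrt (by linarith)) (by linarith))
      (h.trans (mul_le_mul_of_nonneg_left hb (by positivity)))
  calc (√(2 * Real.pi))⁻¹ * (1 - ε) * b⁻¹ * √(2 * L)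
      = ((1 - ε) * √(2 * L)) / (√(2 * Real.pi) * b) := by field_simp
    _ ≤ σ := by
      rw [div_le_iff₀ (by positivity)]
      linarith

theorem max_le_third {c₀ a b : ℝ} (hc₀ : 1 ≤ c₀) (h : max a b ≤ 1 / (3 * c₀)) :
    a ≤ 1 / 3 ∧ b ≤ 1 / 3 := by
  have : 1 / (3 * c₀) ≤ 1 / 3 := one_div_le_one_div_of_le (by norm_num) (by linarith)
  exact max_le_iff.1 (h.trans this)

/-! ### Asymptotics -/

/-- A property that holds eventually for each `ε`, and for each `n` at some `ε < 1`, holds along a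
single null sequence. -/
theorem exists_tendsto_zero_of_eventually (B : ℕ → ℝ → Prop)
    (h1 : ∀ ε ∈ Set.Ioo (0 : ℝ) 1, ∀ᶠ n in atTop, B n ε)
    (h2 : ∀ n, ∃ ε ∈ Set.Ioo (0 : ℝ) 1, B n ε) :
    ∃ η : ℕ → ℝ, (∀ n, η n ∈ Set.Ioo (0 : ℝ) 1) ∧ Tendsto η atTop (𝓝 0) ∧
      ∀ n, B n (η n) := by
  set S : ℕ → Set ℝ := fun n => {ε | ε ∈ Set.Ioo (0 : ℝ) 1 ∧ B n ε}
  have hbdd : ∀ n, BddBelow (S n) := fun n => ⟨0, fun ε hε => hε.1.1.le⟩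
  have hex : ∀ n : ℕ, ∃ ε ∈ S n, ε < sInf (S n) + 1 / ((n : ℝ) + 1) := fun n =>
    exists_lt_of_csInf_lt (h2 n) (lt_add_of_pos_right _ (by positivity))
  choose η hη hηlt using hex
  refine ⟨η, fun n => (hη n).1, ?_, fun n => (hη n).2⟩
  rw [tendsto_order]
  refine ⟨fun a ha => Eventually.of_forall fun n => ha.trans (hη n).1.1, fun a ha => ?_⟩
  have hε : min (a / 2) (1 / 2) ∈ Set.Ioo (0 : ℝ) 1 :=
    ⟨by positivity, (min_le_right _ _).trans_lt (by norm_num)⟩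
  filter_upwards [h1 _ hε,
    tendsto_one_div_add_atTop_nhds_zero_nat.eventually_lt_const (half_pos ha)] with n hn hn'
  have h3 : sInf (S n) ≤ min (a / 2) (1 / 2) := csInf_le (hbdd n) ⟨hε, hn⟩
  have h4 := min_le_left (a / 2) (1 / 2 : ℝ)
  have h5 := hηlt n
  linarith

theorem sparsity_mul_log {n m : ℕ} (hn : 2 ≤ n) :
    sparsity n m * Real.log n = Real.log ((n : ℝ) / m) := by
  have : Real.log n ≠ 0 := (Real.log_pos (by exact_mod_cast hn)).ne'
  rw [sparsity, div_mul_cancel₀ _ this]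

theorem log_bounds_of_sparsity_mem {n m : ℕ} {ρ : ℝ} (hn : 2 ≤ n) (hm : 0 < m)
    (h : sparsity n m ∈ Set.Icc ρ (1 - ρ)) :
    ρ * Real.log n ≤ Real.log m ∧ ρ * Real.log n ≤ Real.log ((n : ℝ) / m) := by
  have hlog : 0 < Real.log n := Real.log_pos (by exact_mod_cast hn)
  have hs := sparsity_mul_log (m := m) hn
  have h1 := mul_le_mul_of_nonneg_right h.1 hlog.le
  have h2 := mul_le_mul_of_nonneg_right h.2 hlog.le
  have hm' : (m : ℝ) ≠ 0 := by exact_mod_cast hm.ne'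
  have hn' : (n : ℝ) ≠ 0 := by exact_mod_cast (by omega : n ≠ 0)
  rw [hs] at h1 h2
  rw [Real.log_div hn' hm'] at h1 h2 ⊢
  constructor <;> linarith

/-- In the range of sparsities bounded away from `0` and `1`, the numbers of signals and of nulls
and the level `L` are as large as the lower bound on the signal strength requires. -/
theorem large_of_sparsity_mem {n m : ℕ} {ρ α : ℝ} (hn : 2 ≤ n) (hm : 0 < m)
    (h : sparsity n m ∈ Set.Icc ρ (1 - ρ)) (hlarge : 20 ≤ ρ * Real.log n)
    (hα0 : 0 ≤ α) (hα : α ≤ 1 / 3) :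
    300 ≤ m ∧ 2 * m ≤ n ∧
      ρ * Real.log n ≤ Real.log ((n : ℝ) / m) + Real.log ((α + 1 / (m : ℝ))⁻¹) := by
  obtain ⟨h1, h2⟩ := log_bounds_of_sparsity_mem hn hm h
  have hm' : (0 : ℝ) < m := by exact_mod_cast hm
  have hn' : (0 : ℝ) < n := by exact_mod_cast (by omega : 0 < n)
  have he : (6000 : ℝ) ≤ Real.exp 20 :=
    exp_ten_ge.trans (Real.exp_le_exp.2 (by norm_num))
  have hmL : (300 : ℝ) ≤ m := by
    have := (Real.le_log_iff_exp_le hm').1 (hlarge.trans h1)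
    linarith
  have hnL : 2 * (m : ℝ) ≤ n := by
    have := (Real.le_log_iff_exp_le (by positivity)).1 (hlarge.trans h2)
    rw [le_div_iff₀ hm'] at this
    nlinarith
  refine ⟨by exact_mod_cast hmL, by exact_mod_cast hnL, ?_⟩
  have hinv : 1 / (m : ℝ) ≤ 1 / 300 := one_div_le_one_div_of_le (by norm_num) hmL
  have : 0 ≤ Real.log ((α + 1 / (m : ℝ))⁻¹) :=
    Real.log_nonneg ((one_le_inv₀ (by positivity)).2 (by linarith))
  linarith

theorem tendsto_mul_log_natCast {ρ : ℝ} (hρ : 0 < ρ) :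
    Tendsto (fun n : ℕ => ρ * Real.log n) atTop atTop :=
  (Real.tendsto_log_atTop.comp tendsto_natCast_atTop_atTop).const_mul_atTop hρ

theorem tendsto_rpow_natCast {r : ℝ} (hr : 0 < r) :
    Tendsto (fun n : ℕ => (n : ℝ) ^ r) atTop atTop :=
  (tendsto_rpow_atTop hr).comp tendsto_natCast_atTop_atTop

/-- A bound, uniform in the model and in the procedure, on the right-hand side of the lower bound.
It is what makes the lower bound trivial for each fixed `n` once the error term is close to `1`. -/
theorem lower_bound_le_natCast_mul_sqrt {n m : ℕ} {α β c₀ : ℝ} (hc₀ : 1 ≤ c₀) (hn : 2 ≤ n)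
    (hm : 0 < m) (hmn : m ≤ n) (hα0 : 0 ≤ α) (hβ0 : 0 ≤ β) :
    1 / (√(2 * Real.pi) * c₀) * (1 / (m : ℝ) + β)⁻¹ *
      √(2 * sparsity n m * Real.log n + 2 * Real.log ((α + 1 / (m : ℝ))⁻¹)) ≤
      n * √(4 * Real.log n) := by
  have hm' : (0 : ℝ) < m := by exact_mod_cast hm
  have hm1 : (1 : ℝ) ≤ m := by exact_mod_cast hm
  have hmn' : (m : ℝ) ≤ n := by exact_mod_cast hmn
  have hinv : ∀ a : ℝ, 0 ≤ a → (a + 1 / (m : ℝ))⁻¹ ≤ n := fun a ha => by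
    refine le_trans ?_ hmn'
    rw [inv_le_comm₀ (by positivity) hm', ← one_div]
    linarith
  have h1 : 1 / (√(2 * Real.pi) * c₀) ≤ 1 := by
    rw [div_le_one (mul_pos sqrt_two_pi_pos (by linarith))]
    have : 1 ≤ √(2 * Real.pi) := Real.one_le_sqrt.2 (by have := Real.pi_gt_three; linarith)
    nlinarith
  have h2 : (1 / (m : ℝ) + β)⁻¹ ≤ n := by rw [add_comm]; exact hinv β hβ0
  have h3 : Real.log ((n : ℝ) / m) ≤ Real.log n :=
    Real.log_le_log (by positivity) (div_le_self (by positivity) hm1)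
  have h4 : Real.log ((α + 1 / (m : ℝ))⁻¹) ≤ Real.log n :=
    Real.log_le_log (by positivity) (hinv α hα0)
  have h5 : 2 * sparsity n m * Real.log n + 2 * Real.log ((α + 1 / (m : ℝ))⁻¹) ≤
      4 * Real.log n := by
    rw [mul_assoc, sparsity_mul_log hn]; linarith
  refine mul_le_mul ?_ (Real.sqrt_le_sqrt h5) (Real.sqrt_nonneg _) (by positivity)
  calc _ ≤ 1 * (n : ℝ) := mul_le_mul h1 h2 (by positivity) zero_le_one
    _ = n := one_mul _

theorem uniform_lower_bound {c₀ : ℝ} (hc₀ : 1 ≤ c₀) {ρ : ℝ} (hρ : 0 < ρ) :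
    ∃ η : ℕ → ℝ, (∀ n, η n ∈ Set.Ioo (0 : ℝ) 1) ∧ Tendsto η atTop (𝓝 0) ∧
      ∀ (n : ℕ) (H₁ : Finset (Fin n)) (σ α β : ℝ)
        (K : Kernel (Fin n → ℝ) ℕ) [IsMarkovKernel K],
        2 ≤ n → H₁.Nonempty → sparsity n H₁.card ∈ Set.Icc ρ (1 - ρ) →
        1 ≤ σ → 0 ≤ α → 0 ≤ β → max α β ≤ 1 / (3 * c₀) → IsControlled σ H₁ K α β →
        1 / (√(2 * Real.pi) * c₀) * (1 - η n) * (1 / (H₁.card : ℝ) + β)⁻¹ *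
            √(2 * sparsity n H₁.card * Real.log (n : ℝ) +
              2 * Real.log ((α + 1 / (H₁.card : ℝ))⁻¹)) ≤ σ := by
  refine exists_tendsto_zero_of_eventually (fun n ε => ∀ (H₁ : Finset (Fin n)) (σ α β : ℝ)
        (K : Kernel (Fin n → ℝ) ℕ) [IsMarkovKernel K],
        2 ≤ n → H₁.Nonempty → sparsity n H₁.card ∈ Set.Icc ρ (1 - ρ) →
        1 ≤ σ → 0 ≤ α → 0 ≤ β → max α β ≤ 1 / (3 * c₀) → IsControlled σ H₁ K α β →
        1 / (√(2 * Real.pi) * c₀) * (1 - ε) * (1 / (H₁.card : ℝ) + β)⁻¹ *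
            √(2 * sparsity n H₁.card * Real.log (n : ℝ) +
              2 * Real.log ((α + 1 / (H₁.card : ℝ))⁻¹)) ≤ σ) ?_ ?_
  · intro ε hε
    filter_upwards [(tendsto_mul_log_natCast hρ).eventually_ge_atTop (20 / ε ^ 2)]
      with n hlog H₁ σ α β K _ hn hne hs hσ hα0 hβ0 hmax hK
    obtain ⟨hα, hβ⟩ := max_le_third hc₀ hmax
    have hε20 : 20 ≤ 20 / ε ^ 2 := by
      rw [le_div_iff₀ (pow_pos hε.1 2)]
      have := pow_le_one₀ hε.1.le hε.2.le (n := 2)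
      linarith
    obtain ⟨hm, hmn, hL⟩ := large_of_sparsity_mem hn hne.card_pos hs (hε20.trans hlog) hα0 hα
    have h := signal_strength_ge hm hmn (by linarith) hα0 hα hβ0 hβ hε.1 hε.2.le
      (hlog.trans hL) le_rfl le_rfl hK
    rw [mul_assoc 2 (sparsity _ _), sparsity_mul_log hn, ← mul_add]
    have hs0 := sqrt_two_pi_pos
    refine le_trans ?_ h
    have h1 : 1 / (√(2 * Real.pi) * c₀) ≤ (√(2 * Real.pi))⁻¹ := by
      rw [one_div]
      exact inv_anti₀ hs0 (le_mul_of_one_le_right hs0.le hc₀)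
    have h2 : 0 ≤ 1 - ε := by linarith [hε.2]
    gcongr
  · intro n
    set D : ℝ := n * √(4 * Real.log n)
    have hD : 0 ≤ D := by positivity
    -- `1 - ε = 1 / (D + 2)`, where `D` bounds the right-hand side.
    refine ⟨1 - 1 / (D + 2), ⟨?_, ?_⟩, ?_⟩
    · rw [sub_pos, div_lt_one (by positivity)]; linarith
    · rw [sub_lt_self_iff]; positivity
    · intro H₁ σ α β K _ hn hne hs hσ hα0 hβ0 hmax hK
      have h := lower_bound_le_natCast_mul_sqrt hc₀ hn hne.card_pos
        (by simpa using Finset.card_le_univ H₁) hα0 hβ0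
      refine le_trans ?_ hσ
      calc _ = (1 / (√(2 * Real.pi) * c₀) * (1 / (H₁.card : ℝ) + β)⁻¹ *
            √(2 * sparsity n H₁.card * Real.log (n : ℝ) +
              2 * Real.log ((α + 1 / (H₁.card : ℝ))⁻¹))) * (1 / (D + 2)) := by ring
        _ ≤ D * (1 / (D + 2)) := by gcongr
        _ ≤ 1 := by
          rw [mul_one_div, div_le_one (by positivity)]; linarith

/-- Under polynomial scalings of `m`, `α` and `β`, the reciprocal `1 / m` is at most of the order of
the polynomial bounds on `α` and `β`, and `L` is `(s + κα) * log n` up to a constant. -/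
theorem polynomial_lower_bound {c₀ : ℝ} (hc₀ : 1 ≤ c₀) {C : ℝ} (hC : 1 ≤ C) :
    ∃ c : ℝ, 0 < c ∧
      ∀ s κα κβ : ℝ, 0 < s → s < 1 → 0 ≤ κα → 0 ≤ κβ → max κα κβ ≤ 1 - s →
        ∀ (H₁ : (n : ℕ) → Finset (Fin n)) (σ α β : ℕ → ℝ)
          (K : (n : ℕ) → Kernel (Fin n → ℝ) ℕ) [∀ n, IsMarkovKernel (K n)],
          (∀ᶠ n : ℕ in atTop,
            C⁻¹ * (n : ℝ) ^ (1 - s) ≤ ((H₁ n).card : ℝ) ∧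
            ((H₁ n).card : ℝ) ≤ C * (n : ℝ) ^ (1 - s) ∧
            1 ≤ σ n ∧ 0 ≤ α n ∧ 0 ≤ β n ∧ max (α n) (β n) ≤ 1 / (3 * c₀) ∧
            α n ≤ C * (n : ℝ) ^ (-κα) ∧ β n ≤ C * (n : ℝ) ^ (-κβ) ∧
            IsControlled (σ n) (H₁ n) (K n) (α n) (β n)) →
          ∀ᶠ n : ℕ in atTop,
            c * (n : ℝ) ^ κβ * √(2 * (s + κα) * Real.log (n : ℝ)) ≤ σ n := by
  have hC0 : 0 < C := by linarith
  have hs0 := sqrt_two_pi_pos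
  refine ⟨(√(2 * Real.pi))⁻¹ / (8 * C), by positivity, ?_⟩
  intro s κα κβ hs hs1 hκα hκβ hmaxκ H₁ σ α β K _ hev
  obtain ⟨hκα1, hκβ1⟩ := max_le_iff.1 hmaxκ
  filter_upwards [hev, eventually_ge_atTop 1,
    (tendsto_mul_log_natCast hs).eventually_ge_atTop (160 + 2 * Real.log (2 * C ^ 2)),
    (tendsto_rpow_natCast hs).eventually_ge_atTop (2 * C),
    (tendsto_rpow_natCast (sub_pos.2 hs1)).eventually_ge_atTop (300 * C)]
    with n ⟨hm1, hm2, hσ, hα0, hβ0, hmax, hα, hβ, hK⟩ hn hlog hns hns1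
  obtain ⟨hα3, hβ3⟩ := max_le_third hc₀ hmax
  have hn0 : (0 : ℝ) < n := by exact_mod_cast hn
  have hn1 : (1 : ℝ) ≤ n := by exact_mod_cast hn
  have hlog0 : 0 ≤ Real.log n := Real.log_nonneg hn1
  have hm300 : (300 : ℝ) ≤ (H₁ n).card := by
    refine le_trans ?_ hm1
    rw [inv_mul_eq_div, le_div_iff₀ hC0]; exact hns1
  set m : ℝ := ((H₁ n).card : ℝ) with hmdef
  have hm0 : 0 < m := by linarith
  have hsplit : (n : ℝ) ^ s * (n : ℝ) ^ (1 - s) = n := by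
    rw [← Real.rpow_add hn0]; simp
  have h1s : 0 < (n : ℝ) ^ (1 - s) := by positivity
  have hmn : m * (n : ℝ) ^ s ≤ C * n := by
    calc m * (n : ℝ) ^ s ≤ C * (n : ℝ) ^ (1 - s) * (n : ℝ) ^ s := by gcongr
      _ = C * ((n : ℝ) ^ s * (n : ℝ) ^ (1 - s)) := by ring
      _ = C * n := by rw [hsplit]
  have h2mn : 2 * m ≤ n := by
    have : m * (2 * C) ≤ C * n := (mul_le_mul_of_nonneg_left hns hm0.le).trans hmn
    refine le_of_mul_le_mul_left ?_ hC0
    linarith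
  have hinv : 1 / m ≤ C * (n : ℝ) ^ (-(1 - s)) := by
    rw [Real.rpow_neg hn0.le, div_le_iff₀ hm0]
    rw [inv_mul_eq_div, div_le_iff₀ hC0] at hm1
    calc (1 : ℝ) = ((n : ℝ) ^ (1 - s))⁻¹ * (n : ℝ) ^ (1 - s) := (inv_mul_cancel₀ h1s.ne').symm
      _ ≤ ((n : ℝ) ^ (1 - s))⁻¹ * (m * C) := by gcongr
      _ = _ := by ring
  have hinvκ : ∀ κ : ℝ, κ ≤ 1 - s → 1 / m ≤ C * (n : ℝ) ^ (-κ) := fun κ hκ =>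
    hinv.trans (mul_le_mul_of_nonneg_left
      (Real.rpow_le_rpow_of_exponent_le hn1 (by linarith)) hC0.le)
  have hα' : α n + 1 / m ≤ 2 * C * (n : ℝ) ^ (-κα) := by
    have := hinvκ κα hκα1; linarith
  have hβ' : 1 / m + β n ≤ 2 * C * (n : ℝ) ^ (-κβ) := by
    have := hinvκ κβ hκβ1; linarith
  have hα'0 : 0 < α n + 1 / m := by positivity
  have hlogα : κα * Real.log n - Real.log (2 * C) ≤ Real.log ((α n + 1 / m)⁻¹) := by
    rw [Real.log_inv]
    have := Real.log_le_log hα'0 hα'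
    rw [Real.log_mul (by positivity) (by positivity), Real.log_rpow hn0] at this
    linarith
  have hlognm : s * Real.log n - Real.log C ≤ Real.log ((n : ℝ) / m) := by
    have h1 : (n : ℝ) ^ s / C ≤ n / m := by
      rw [div_le_div_iff₀ hC0 hm0]; linarith
    have := Real.log_le_log (by positivity) h1
    rwa [Real.log_div (by positivity) (by positivity), Real.log_rpow hn0] at this
  have hlogC : Real.log (2 * C ^ 2) = Real.log (2 * C) + Real.log C := by
    rw [← Real.log_mul (by positivity) (by positivity)]; ring_nf
  have hlogC0 : 0 ≤ Real.log (2 * C ^ 2) :=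
    Real.log_nonneg (by nlinarith)
  have hκlog : 0 ≤ κα * Real.log n := mul_nonneg hκα hlog0
  have h := signal_strength_ge (ε := 1 / 2) (b := 2 * C * (n : ℝ) ^ (-κβ))
    (L := (s + κα) * Real.log n / 2 ) (H₁ := H₁ n)
    (Nat.cast_le.1 (by rw [← hmdef]; exact_mod_cast hm300 : ((300 : ℕ) : ℝ) ≤ (H₁ n).card))
    (by rw [hmdef] at h2mn; exact_mod_cast h2mn) (by linarith) hα0 hα3 hβ0 hβ3
    (by norm_num) (by norm_num) (by norm_num; linarith) (by linarith) hβ' hK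
  refine le_trans ?_ h
  have hT : 0 ≤ (s + κα) * Real.log n := by positivity
  have hsqrt : √(2 * (s + κα) * Real.log n) ≤ 2 * √(2 * ((s + κα) * Real.log n / 2)) := by
    rw [Real.sqrt_le_left (by positivity), mul_pow, Real.sq_sqrt (by linarith)]
    linarith
  calc (√(2 * Real.pi))⁻¹ / (8 * C) * (n : ℝ) ^ κβ * √(2 * (s + κα) * Real.log n)
      ≤ (√(2 * Real.pi))⁻¹ / (8 * C) * (n : ℝ) ^ κβ *
        (2 * √(2 * ((s + κα) * Real.log n / 2))) := by gcongr
    _ = _ := by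
      rw [Real.rpow_neg hn0.le]
      field_simp
      norm_num

theorem polynomial_growth {c₀ : ℝ} (hc₀ : 1 ≤ c₀) {ρ κ : ℝ} (hρ : 0 < ρ) (hκ : 0 < κ) :
    ∃ γ : ℝ, 0 < γ ∧
      ∀ (C : ℝ) (H₁ : (n : ℕ) → Finset (Fin n)) (σ α β : ℕ → ℝ)
        (K : (n : ℕ) → Kernel (Fin n → ℝ) ℕ) [∀ n, IsMarkovKernel (K n)],
        (∀ᶠ n : ℕ in atTop,
          (H₁ n).Nonempty ∧ sparsity n (H₁ n).card ∈ Set.Icc ρ (1 - ρ) ∧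
          1 ≤ σ n ∧ 0 ≤ α n ∧ 0 ≤ β n ∧ max (α n) (β n) ≤ 1 / (3 * c₀) ∧
          β n ≤ C * (n : ℝ) ^ (-κ) ∧
          IsControlled (σ n) (H₁ n) (K n) (α n) (β n)) →
        ∀ᶠ n : ℕ in atTop, (n : ℝ) ^ γ ≤ σ n := by
  -- Half of the exponent `min ρ κ` absorbs the constants.
  obtain ⟨γ, hγ, hγρ, hγκ⟩ : ∃ γ : ℝ, 0 < γ ∧ 2 * γ ≤ ρ ∧ 2 * γ ≤ κ :=
    ⟨min ρ κ / 2, by positivity, by linarith [min_le_left ρ κ], by linarith [min_le_right ρ κ]⟩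
  refine ⟨γ, hγ, ?_⟩
  intro C H₁ σ α β K _ hev
  filter_upwards [hev, eventually_ge_atTop 2,
    (tendsto_mul_log_natCast hρ).eventually_ge_atTop 80,
    (tendsto_rpow_natCast hγ).eventually_ge_atTop (√(2 * Real.pi) * (1 + |C|))]
    with n ⟨hne, hs, hσ, hα0, hβ0, hmax, hβ, hK⟩ hn hlog hnγ
  obtain ⟨hα3, hβ3⟩ := max_le_third hc₀ hmax
  obtain ⟨hm, hmn, hL⟩ := large_of_sparsity_mem hn hne.card_pos hs (by linarith) hα0 hα3
  obtain ⟨hlogm, -⟩ := log_bounds_of_sparsity_mem hn hne.card_pos hs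
  have hn0 : (0 : ℝ) < n := by exact_mod_cast (by omega : 0 < n)
  have hn1 : (1 : ℝ) ≤ n := by exact_mod_cast (by omega : 1 ≤ n)
  have hm0 : (0 : ℝ) < (H₁ n).card := by exact_mod_cast hne.card_pos
  have hs0 := sqrt_two_pi_pos
  have hinv : 1 / ((H₁ n).card : ℝ) ≤ (n : ℝ) ^ (-(2 * γ)) := by
    have h1 : (n : ℝ) ^ (2 * γ) ≤ (H₁ n).card := by
      refine (Real.rpow_le_rpow_of_exponent_le hn1 hγρ).trans ?_
      rw [← Real.log_le_log_iff (by positivity) hm0, Real.log_rpow hn0]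
      exact hlogm
    rw [Real.rpow_neg hn0.le, ← one_div]
    exact one_div_le_one_div_of_le (by positivity) h1
  have hβ' : β n ≤ |C| * (n : ℝ) ^ (-(2 * γ)) := by
    refine hβ.trans (mul_le_mul (le_abs_self C) ?_ (by positivity) (abs_nonneg C))
    exact Real.rpow_le_rpow_of_exponent_le hn1 (by linarith)
  have h := signal_strength_ge (ε := 1 / 2) (b := (1 + |C|) * (n : ℝ) ^ (-(2 * γ)))
    (L := 80) hm hmn (by linarith) hα0 hα3 hβ0 hβ3
    (by norm_num) (by norm_num) (by norm_num) (by linarith) (by linarith) hK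
  refine le_trans ?_ h
  have hsqrt : (2 : ℝ) ≤ √(2 * 80) := Real.le_sqrt_of_sq_le (by norm_num)
  have hC : 0 < 1 + |C| := by positivity
  have hsq : (n : ℝ) ^ (2 * γ) = (n : ℝ) ^ γ * (n : ℝ) ^ γ := by
    rw [two_mul, Real.rpow_add hn0]
  calc (n : ℝ) ^ γ = (√(2 * Real.pi) * (1 + |C|))⁻¹ * ((√(2 * Real.pi) * (1 + |C|)) *
        (n : ℝ) ^ γ) := by field_simp
    _ ≤ (√(2 * Real.pi) * (1 + |C|))⁻¹ * (n : ℝ) ^ (2 * γ) := by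
      rw [hsq]; gcongr
    _ = (√(2 * Real.pi))⁻¹ * (1 - 1 / 2) * ((1 + |C|) * (n : ℝ) ^ (-(2 * γ)))⁻¹ * 2 := by
      rw [Real.rpow_neg hn0.le]
      field_simp
      norm_num
    _ ≤ _ := by
      have : (0 : ℝ) ≤ 1 - 1 / 2 := by norm_num
      gcongr

end MultTest

theorem mainTheorem3 (c₀ : ℝ) (hc₀ : 1 ≤ c₀) :
    -- the lower bound, with an error `η n → 0` that depends only on `ρ` and `c₀`
    (∀ ρ : ℝ, 0 < ρ → ρ < 1 / 2 →
      ∃ η : ℕ → ℝ, (∀ n, η n ∈ Set.Ioo (0 : ℝ) 1) ∧ Tendsto η atTop (𝓝 0) ∧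
        ∀ (n : ℕ) (H₁ : Finset (Fin n)) (σ α β : ℝ)
          (K : Kernel (Fin n → ℝ) ℕ) [IsMarkovKernel K],
          2 ≤ n → H₁.Nonempty →
          MultTest.sparsity n H₁.card ∈ Set.Icc ρ (1 - ρ) →
          1 ≤ σ → 0 ≤ α → 0 ≤ β → max α β ≤ 1 / (3 * c₀) →
          MultTest.IsControlled σ H₁ K α β →
          1 / (Real.sqrt (2 * Real.pi) * c₀) * (1 - η n) * (1 / (H₁.card : ℝ) + β)⁻¹ *
              Real.sqrt (2 * MultTest.sparsity n H₁.card * Real.log (n : ℝ) +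
                2 * Real.log ((α + 1 / (H₁.card : ℝ))⁻¹)) ≤ σ) ∧
    -- the bound under polynomial scalings of the number of signals, the FDR and the FNR
    (∀ C : ℝ, 1 ≤ C → ∃ c : ℝ, 0 < c ∧
      ∀ s κα κβ : ℝ, 0 < s → s < 1 → 0 ≤ κα → 0 ≤ κβ → max κα κβ ≤ 1 - s →
        ∀ (H₁ : (n : ℕ) → Finset (Fin n)) (σ α β : ℕ → ℝ)
          (K : (n : ℕ) → Kernel (Fin n → ℝ) ℕ) [∀ n, IsMarkovKernel (K n)],
          (∀ᶠ n : ℕ in atTop,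
            C⁻¹ * (n : ℝ) ^ (1 - s) ≤ ((H₁ n).card : ℝ) ∧
            ((H₁ n).card : ℝ) ≤ C * (n : ℝ) ^ (1 - s) ∧
            1 ≤ σ n ∧ 0 ≤ α n ∧ 0 ≤ β n ∧ max (α n) (β n) ≤ 1 / (3 * c₀) ∧
            α n ≤ C * (n : ℝ) ^ (-κα) ∧ β n ≤ C * (n : ℝ) ^ (-κβ) ∧
            MultTest.IsControlled (σ n) (H₁ n) (K n) (α n) (β n)) →
          ∀ᶠ n : ℕ in atTop,
            c * (n : ℝ) ^ κβ * Real.sqrt (2 * (s + κα) * Real.log (n : ℝ)) ≤ σ n) ∧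
    -- polynomial decay of the FNR forces polynomial growth of the signal strength
    (∀ ρ κ : ℝ, 0 < ρ → ρ < 1 / 2 → 0 < κ → ∃ γ : ℝ, 0 < γ ∧
      ∀ (C : ℝ) (H₁ : (n : ℕ) → Finset (Fin n)) (σ α β : ℕ → ℝ)
        (K : (n : ℕ) → Kernel (Fin n → ℝ) ℕ) [∀ n, IsMarkovKernel (K n)],
        (∀ᶠ n : ℕ in atTop,
          (H₁ n).Nonempty ∧ MultTest.sparsity n (H₁ n).card ∈ Set.Icc ρ (1 - ρ) ∧
          1 ≤ σ n ∧ 0 ≤ α n ∧ 0 ≤ β n ∧ max (α n) (β n) ≤ 1 / (3 * c₀) ∧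
          β n ≤ C * (n : ℝ) ^ (-κ) ∧
          MultTest.IsControlled (σ n) (H₁ n) (K n) (α n) (β n)) →
        ∀ᶠ n : ℕ in atTop, (n : ℝ) ^ γ ≤ σ n) :=
  ⟨fun _ hρ _ => MultTest.uniform_lower_bound hc₀ hρ,
    fun _ hC => MultTest.polynomial_lower_bound hc₀ hC,
    fun _ _ hρ _ hκ => MultTest.polynomial_growth hc₀ hρ hκ⟩
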